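/- Let $1\le N\le 4$, let $\Omega\subset\mathbb{R}^N$ be a bounded domain (nonempty, open, connected; no regularity of $\partial\Omega$ is needed), let $m\in\mathbb{N}$, and let $H=H_0^1(\Omega,\mathbb{R}^m)=H_0^1(\Omega)^m$, where $H_0^1(\Omega)$ is the closure of $C_c^\infty(\Omega)$ in $H^1(\Omega)$. Let $\varepsilon_1,\dots,\varepsilon_m>0$. Let $\mathbf g=(g_{ij})\in\mathbb{R}^{m\times m}$ be a symmetric matrix such that either $g_{ij}>0$ for all $i,j$, or $\mathbf g$ is positive definite. Let $a_1,\dots,a_m\in L^\infty(\Omega)$ satisfy $a_i(x)>-\lambda_1$ for a.e. $x\in\Omega$ and all $i$, where $\lambda_1$ is the first Dirichlet eigenvalue of $-\Delta$ in $\Omega$. For $\mathbf u=(u_1,\dots,u_m)\in H$ put $$E(\mathbf u)=\frac12\int_\Omega\sum_{i=1}^m\bigl(\varepsilon_i|\nabla u_i|^2+a_iu_i^2\bigr)\,dx-\frac14\int_\Omega\sum_{i,j=1}^m g_{ij}u_i^2u_j^2\,dx .$$ Then $E\in C^2(H,\mathbb{R})$. Let $\mathcal N=\{\mathbf u\in H\setminus\{0\}:\langle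 E'(\mathbf u),\mathbf u\rangle=0\}$ be the Nehari manifold, with the topology induced by $H$. A $1$-saddle of $E$ in $H$ is a point $\mathbf u\in H$ with $E'(\mathbf u)=0$ and Morse index $1$, i.e. the maximal dimension of a subspace of $H$ on which the quadratic form $\mathbf v\mapsto\langle E''(\mathbf u)\mathbf v,\mathbf v\rangle$ is negative definite is $1$; it is nondegenerate if $E''(\mathbf u):H\to H^*$ is invertible with bounded inverse. The following hold. (a) Every local minimizer of $E$ on $\mathcal N$ is a $1$-saddle of $E$ in $H$. (b) Every nondegenerate $1$-saddle $\mathbf u\neq0$ of $E$ in $H$ belongs to $\mathcal N$ and is a strict local minimizer of $E$ on $\mathcal N$. -/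

import Mathlib

open MeasureTheory Filter
open scoped Topology ContDiff Gradient

noncomputable section

namespace Nehari

/-- The `N`-dimensional Euclidean space. -/
abbrev Eucl (N : ℕ) : Type := EuclideanSpace ℝ (Fin N)

/-- The Hilbert space `L²(Ω) × L²(Ω, ℝ^N)`, with `‖(u, p)‖² = ∫_Ω u² + ∫_Ω |p|²`. -/
abbrev L2Pair {N : ℕ} (Ω : Set (Eucl N)) : Type :=
  WithLp 2 (Lp ℝ 2 (volume.restrict Ω) × Lp (Eucl N) 2 (volume.restrict Ω))

/-- `φ` is a test function on `Ω`: smooth, with compact support contained in `Ω`. -/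
structure IsTestFunction {N : ℕ} (Ω : Set (Eucl N)) (φ : Eucl N → ℝ) : Prop where
  contDiff : ContDiff ℝ ∞ φ
  hasCompactSupport : HasCompactSupport φ
  tsupport_subset : tsupport φ ⊆ Ω

/-- The pairs `(φ, ∇φ)`, `φ ∈ C_c^∞(Ω)`, as a linear subspace of `L²(Ω) × L²(Ω, ℝ^N)`. -/
def testGraph {N : ℕ} (Ω : Set (Eucl N)) : Submodule ℝ (L2Pair Ω) where
  carrier := {w | ∃ φ : Eucl N → ℝ, IsTestFunction Ω φ ∧
    w.fst =ᵐ[volume.restrict Ω] φ ∧ w.snd =ᵐ[volume.restrict Ω] ∇ φ}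
  zero_mem' := by
    refine ⟨fun _ => 0, ⟨contDiff_const, HasCompactSupport.zero, by simp [tsupport]⟩, ?_, ?_⟩
    · exact Lp.coeFn_zero ℝ 2 (volume.restrict Ω)
    · filter_upwards [Lp.coeFn_zero (Eucl N) 2 (volume.restrict Ω)] with x hx
      simpa [gradient] using hx
  add_mem' := by
    rintro v w ⟨φ, hφ, hv1, hv2⟩ ⟨ψ, hψ, hw1, hw2⟩
    refine ⟨φ + ψ, ⟨hφ.contDiff.add hψ.contDiff,
      hφ.hasCompactSupport.add hψ.hasCompactSupport, ?_⟩, ?_, ?_⟩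
    · exact (tsupport_add φ ψ).trans (Set.union_subset hφ.tsupport_subset hψ.tsupport_subset)
    · filter_upwards [Lp.coeFn_add v.fst w.fst, hv1, hw1] with x h h1 h2
      refine h.trans ?_
      simp [h1, h2]
    · filter_upwards [Lp.coeFn_add v.snd w.snd, hv2, hw2] with x h h1 h2
      have d1 : DifferentiableAt ℝ φ x := (hφ.contDiff.differentiable (by simp)) x
      have d2 : DifferentiableAt ℝ ψ x := (hψ.contDiff.differentiable (by simp)) x
      refine h.trans ?_
      simp [h1, h2, gradient, fderiv_add d1 d2]
  smul_mem' := by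
    rintro c w ⟨φ, hφ, hw1, hw2⟩
    refine ⟨c • φ, ⟨hφ.contDiff.const_smul c, ?_, ?_⟩, ?_, ?_⟩
    · exact hφ.hasCompactSupport.smul_left (f := fun _ => c)
    · exact (tsupport_smul_subset_right (fun _ => c) φ).trans hφ.tsupport_subset
    · filter_upwards [Lp.coeFn_smul c w.fst, hw1] with x h h1
      simp [h, h1]
    · filter_upwards [Lp.coeFn_smul c w.snd, hw2] with x h h1
      have d1 : DifferentiableAt ℝ φ x := (hφ.contDiff.differentiable (by simp)) x
      simp [h, h1, gradient, fderiv_const_smul d1]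

/-- The Sobolev space `H_0^1(Ω)`: the closure of `C_c^∞(Ω)` in the norm
`(∫_Ω u² + ∫_Ω |∇u|²)^{1/2}`. A function `u ∈ H_0^1(Ω)` is represented by the pair `(u, ∇u)` of
itself and its weak gradient (which `u` determines). For bounded `Ω` this norm is equivalent to
every norm `(∫_Ω ε |∇u|²)^{1/2}`, `ε > 0`. -/
abbrev H01 {N : ℕ} (Ω : Set (Eucl N)) : Submodule ℝ (L2Pair Ω) :=
  (testGraph Ω).topologicalClosure

/-- The function in `L²(Ω)` underlying an element of `H_0^1(Ω)`. -/
def fn {N : ℕ} {Ω : Set (Eucl N)} (u : H01 Ω) : Lp ℝ 2 (volume.restrict Ω) :=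
  (u : L2Pair Ω).fst

/-- The weak gradient of an element of `H_0^1(Ω)`. -/
def grad {N : ℕ} {Ω : Set (Eucl N)} (u : H01 Ω) : Lp (Eucl N) 2 (volume.restrict Ω) :=
  (u : L2Pair Ω).snd

/-- The Hilbert space `H_0^1(Ω, ℝ^m) = H_0^1(Ω)^m`. -/
abbrev HSpace {N : ℕ} (Ω : Set (Eucl N)) (m : ℕ) : Type :=
  PiLp 2 (fun _ : Fin m => H01 Ω)

/-- `lam` is a Dirichlet eigenvalue of `-Δ` in `Ω`: there is a nonzero `u ∈ H_0^1(Ω)` with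
`-Δu = lam u` weakly. -/
def IsDirichletEigenvalue {N : ℕ} (Ω : Set (Eucl N)) (lam : ℝ) : Prop :=
  ∃ u : H01 Ω, u ≠ 0 ∧ ∀ v : H01 Ω,
    (∫ x in Ω, inner ℝ (grad u x) (grad v x)) = lam * (∫ x in Ω, fn u x * fn v x)

/-- The first Dirichlet eigenvalue `λ₁` of `-Δ` in `Ω`. -/
def firstDirichletEigenvalue {N : ℕ} (Ω : Set (Eucl N)) : ℝ :=
  sInf {lam | IsDirichletEigenvalue Ω lam}

/-- The energy `E(u) = ½ ∫_Ω ∑ᵢ (εᵢ |∇uᵢ|² + aᵢ uᵢ²) - ¼ ∫_Ω ∑ᵢⱼ gᵢⱼ uᵢ² uⱼ²`. -/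
def energy {N : ℕ} (Ω : Set (Eucl N)) {m : ℕ} (ε : Fin m → ℝ) (a : Fin m → Eucl N → ℝ)
    (g : Matrix (Fin m) (Fin m) ℝ) (u : HSpace Ω m) : ℝ :=
  (1 / 2) * (∫ x in Ω, ∑ i, (ε i * ‖grad (u i) x‖ ^ 2 + a i x * (fn (u i) x) ^ 2))
    - (1 / 4) * (∫ x in Ω, ∑ i, ∑ j, g i j * (fn (u i) x) ^ 2 * (fn (u j) x) ^ 2)

section Abstract

variable {H : Type*} [NormedAddCommGroup H] [NormedSpace ℝ H]

/-- `u` is a critical point of `E`: `E` is Fréchet differentiable at `u` and `E'(u) = 0`. -/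
def IsCriticalPoint (E : H → ℝ) (u : H) : Prop :=
  HasFDerivAt E (0 : H →L[ℝ] ℝ) u

/-- The second Fréchet derivative `E''(u) : H → H*`. -/
def hessian (E : H → ℝ) (u : H) : H →L[ℝ] (H →L[ℝ] ℝ) :=
  fderiv ℝ (fderiv ℝ E) u

/-- The subspace `V` is negative definite for the bilinear form `B`. -/
def IsNegDefOn (B : H →L[ℝ] (H →L[ℝ] ℝ)) (V : Submodule ℝ H) : Prop :=
  ∀ v ∈ V, v ≠ 0 → B v v < 0

/-- The Morse index of `E` at `u`: the maximal dimension (possibly `∞`) of a subspace on which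
`E''(u)` is negative definite. -/
def morseIndex (E : H → ℝ) (u : H) : ℕ∞ :=
  ⨆ (V : Submodule ℝ H) (_ : IsNegDefOn (hessian E u) V), Cardinal.toENat (Module.rank ℝ V)

/-- A `1`-saddle of `E`: a critical point with Morse index `1`. -/
def IsOneSaddle (E : H → ℝ) (u : H) : Prop :=
  IsCriticalPoint E u ∧ morseIndex E u = 1

/-- `u` is nondegenerate for `E`: `E''(u) : H → H*` is invertible, with bounded inverse. -/
def IsNondegenerate (E : H → ℝ) (u : H) : Prop :=
  (hessian E u).IsInvertible

/-- The Nehari manifold `{u ∈ H \ {0} : ⟨E'(u), u⟩ = 0}`. -/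
def nehari (E : H → ℝ) : Set H :=
  {u | u ≠ 0 ∧ fderiv ℝ E u u = 0}

/-- `u` is a local minimizer of `E` on the set `S`. -/
def IsLocalMinimizerOn (E : H → ℝ) (S : Set H) (u : H) : Prop :=
  u ∈ S ∧ IsLocalMinOn E S u

/-- `u` is a strict local minimizer of `E` on the set `S`. -/
def IsStrictLocalMinimizerOn (E : H → ℝ) (S : Set H) (u : H) : Prop :=
  u ∈ S ∧ ∀ᶠ v in 𝓝[S] u, v ≠ u → E u < E v

end Abstract

end Nehari

end

/-!
Split `E = Q / 2 - G / 4` into its quadratic and quartic parts. Along a ray `t ↦ t u` the energy is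
`t² Q(u) / 2 - t⁴ G(u) / 4`, so `⟨E'(u), u⟩ = Q(u) - G(u)` and `⟨E''(u) u, u⟩ = Q(u) - 3 G(u)`.
On the Nehari manifold this gives `⟨E''(u) u, u⟩ = -2 G(u)`, which is negative: if `G(u) = 0`, then
strict copositivity of `g` forces `u = 0` in `L²`, and `Q(u) = 0` then forces `∇u = 0`. The
embedding of `H_0^1` in `L⁴`, valid in dimension at most four, makes `G` finite and smooth.

What remains is a general fact about a `C²` function `E` with `⟨E''(u) u, u⟩ < 0` on its Nehari
manifold, which away from the origin is the zero set of `J(v) = ⟨E'(v), v⟩`.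

* At a local minimizer `u` there is a Lagrange multiplier, and it vanishes when tested on `u`
  because `J'(u) u = ⟨E''(u) u, u⟩ ≠ 0`; so `u` is a critical point and `J'(u) = E''(u) u`.
  Minimality along the curves of `{J = 0}` makes `E''(u)` nonnegative on the kernel of `J'(u)`, a
  hyperplane, so the Morse index is one.
* At a nondegenerate one-saddle, reflecting the negative direction `u` turns `E''(u)` into a
  nonnegative invertible form, which is therefore coercive. Along the Nehari manifold the two forms
  differ by `o(‖v - u‖²)`, since `E''(u) u (v - u) = o(‖v - u‖)` there.
-/

namespace Nehari

section BilinearForm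

variable {H : Type*} [NormedAddCommGroup H] [NormedSpace ℝ H] {B : H →L[ℝ] H →L[ℝ] ℝ} {u v : H}

lemma apply_smul_add_smul_self (huv : B u v = 0) (hvu : B v u = 0) (s t : ℝ) :
    B (s • u + t • v) (s • u + t • v) = s ^ 2 * B u u + t ^ 2 * B v v := by
  simp only [map_add, map_smul, add_apply, smul_apply, smul_eq_mul, huv, hvu]
  ring

lemma isNegDefOn_span_singleton (hu : B u u < 0) : IsNegDefOn B (ℝ ∙ u) := by
  intro v hv hv0
  obtain ⟨c, rfl⟩ := Submodule.mem_span_singleton.1 hv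
  have hc : c ≠ 0 := left_ne_zero_of_smul hv0
  simpa [← mul_assoc] using mul_neg_of_pos_of_neg (mul_self_pos.2 hc) hu

lemma isNegDefOn_span_pair (hu : B u u < 0) (hv : B v v < 0) (huv : B u v = 0)
    (hvu : B v u = 0) : IsNegDefOn B (Submodule.span ℝ {u, v}) := by
  intro w hw hw0
  obtain ⟨s, t, rfl⟩ := Submodule.mem_span_pair.1 hw
  rw [apply_smul_add_smul_self huv hvu]
  rcases eq_or_ne s 0 with rfl | hs
  · have ht : t ≠ 0 := by rintro rfl; simp at hw0
    nlinarith [sq_pos_of_ne_zero ht]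
  · nlinarith [sq_pos_of_ne_zero hs, sq_nonneg t]

lemma finrank_span_pair_eq_two (hu : B u u < 0) (hv : B v v < 0) (huv : B u v = 0)
    (hvu : B v u = 0) : Module.finrank ℝ (Submodule.span ℝ {u, v}) = 2 := by
  have hli : LinearIndependent ℝ ![u, v] := by
    refine LinearIndependent.pair_iff.2 fun s t hst => ?_
    have h : s ^ 2 * B u u + t ^ 2 * B v v = 0 := by
      rw [← apply_smul_add_smul_self huv hvu, hst, map_zero]
    constructor <;> by_contra h0 <;>
      nlinarith [sq_pos_of_ne_zero h0, sq_nonneg s, sq_nonneg t]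
  have h := finrank_span_eq_card hli
  rwa [Matrix.range_cons_cons_empty, Fintype.card_fin] at h

lemma IsNegDefOn.rank_le_one {V : Submodule ℝ H} (hV : IsNegDefOn B V) {f : H →ₗ[ℝ] ℝ}
    (hf : ∀ v, f v = 0 → 0 ≤ B v v) : Module.rank ℝ V ≤ 1 := by
  have hinj : Function.Injective (f ∘ₗ V.subtype) := by
    refine (injective_iff_map_eq_zero _).2 fun v hv => ?_
    by_contra hv0
    exact (hV v v.2 (by simpa using hv0)).not_ge (hf v hv)
  simpa using LinearMap.lift_rank_le_of_injective _ hinj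

lemma norm_apply_sq_le (hsymm : ∀ v w, B v w = B w v) (hnn : ∀ v, 0 ≤ B v v) (x : H) :
    ‖B x‖ ^ 2 ≤ ‖B‖ * B x x := by
  have hcs (y : H) : B x y ^ 2 ≤ B x x * B y y :=
    LinearMap.BilinForm.apply_sq_le_of_symm B.toBilinForm hnn ⟨hsymm⟩ x y
  have hbound (y : H) : ‖B x y‖ ≤ √(‖B‖ * B x x) * ‖y‖ := by
    rw [← Real.sqrt_sq (norm_nonneg y), ← Real.sqrt_mul (mul_nonneg (norm_nonneg B) (hnn x))]
    refine Real.abs_le_sqrt ((hcs y).trans ?_)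
    calc B x x * B y y ≤ B x x * (‖B‖ * ‖y‖ * ‖y‖) := by
          gcongr
          · exact hnn x
          · exact (le_abs_self _).trans (B.le_opNorm₂ y y)
      _ = ‖B‖ * B x x * ‖y‖ ^ 2 := by ring
  have h := (B x).opNorm_le_bound (Real.sqrt_nonneg _) hbound
  rwa [Real.le_sqrt (norm_nonneg _) (mul_nonneg (norm_nonneg B) (hnn x))] at h

lemma isCoercive_of_isInvertible (hsymm : ∀ v w, B v w = B w v) (hnn : ∀ v, 0 ≤ B v v)
    (hB : B.IsInvertible) : IsCoercive B := by
  set S := ‖B.inverse‖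
  have hS (x : H) : ‖x‖ ≤ S * ‖B x‖ := by
    simpa only [hB.inverse_apply_self] using B.inverse.le_opNorm (B x)
  refine ⟨(S ^ 2 * ‖B‖ + 1)⁻¹, by positivity, fun x => ?_⟩
  rw [mul_assoc, inv_mul_le_iff₀ (by positivity)]
  calc ‖x‖ * ‖x‖ ≤ (S * ‖B x‖) * (S * ‖B x‖) := by gcongr <;> exact hS x
    _ = S ^ 2 * ‖B x‖ ^ 2 := by ring
    _ ≤ S ^ 2 * (‖B‖ * B x x) := by gcongr; exact norm_apply_sq_le hsymm hnn x
    _ ≤ (S ^ 2 * ‖B‖ + 1) * B x x := by linarith [hnn x]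

/-- The form `(x, y) ↦ B (R x) y`, where `R x = x - (2 B(u, x) / B(u, u)) u` is the `B`-orthogonal
reflection which maps `u` to `-u`. It serves to turn a form whose only negative direction is `u`
into a positive one. -/
noncomputable def reflectedForm (B : H →L[ℝ] H →L[ℝ] ℝ) (u : H) : H →L[ℝ] H →L[ℝ] ℝ :=
  B - (2 / B u u) • (B u).smulRight (B u)

lemma reflectedForm_apply (x y : H) :
    reflectedForm B u x y = B x y - 2 / B u u * (B u x * B u y) := by
  simp [reflectedForm]

lemma isInvertible_reflectedForm (hB : B.IsInvertible) (hu : B u u ≠ 0) :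
    (reflectedForm B u).IsInvertible := by
  let R : H →L[ℝ] H := .id ℝ H - (2 / B u u) • (B u).smulRight u
  have hR : R ∘L R = .id ℝ H := by
    ext x
    have hBu : B u (R x) = - B u x := by
      simp [R, div_mul_eq_mul_div, mul_div_assoc, hu]
      ring
    calc R (R x) = R x - (2 / B u u) • B u (R x) • u := by simp [R]
      _ = x := by rw [hBu]; simp [R]
  have hBR : reflectedForm B u = B ∘L R := by
    ext x y
    simp [R, reflectedForm_apply]
  rw [hBR]
  exact hB.comp (.of_inverse hR hR)

lemma reflectedForm_self_nonneg (hsymm : ∀ v w, B v w = B w v) (hu : B u u < 0)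
    (hnn : ∀ w, B u w = 0 → 0 ≤ B w w) (x : H) : 0 ≤ reflectedForm B u x x := by
  set w := x - (B u x / B u u) • u with hw
  have huw : B u w = 0 := by simp [hw, hu.ne]
  have hdecomp : reflectedForm B u x x = B w w - (B u x) ^ 2 / B u u := by
    have := hu.ne
    simp only [reflectedForm_apply, hw, map_sub, map_smul, sub_apply, smul_apply, smul_eq_mul,
      hsymm x u]
    field_simp
    ring
  rw [hdecomp]
  linarith [hnn w huw, div_nonpos_of_nonneg_of_nonpos (sq_nonneg (B u x)) hu.le]

lemma isCoercive_reflectedForm (hsymm : ∀ v w, B v w = B w v) (hB : B.IsInvertible)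
    (hu : B u u < 0) (hnn : ∀ w, B u w = 0 → 0 ≤ B w w) : IsCoercive (reflectedForm B u) :=
  isCoercive_of_isInvertible (fun v w => by simp only [reflectedForm_apply, hsymm v w, mul_comm])
    (reflectedForm_self_nonneg hsymm hu hnn) (isInvertible_reflectedForm hB hu.ne)

end BilinearForm

section NehariManifold

variable {H : Type*} [NormedAddCommGroup H] [NormedSpace ℝ H] {E : H → ℝ} {u v : H}

lemma hessian_symm (hE : ContDiff ℝ 2 E) (u v w : H) : hessian E u v w = hessian E u w v :=
  (hE.contDiffAt.isSymmSndFDerivAt (by simp)) v w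

lemma contDiff_one_fderiv (hE : ContDiff ℝ 2 E) : ContDiff ℝ 1 (fderiv ℝ E) :=
  hE.fderiv_right (by norm_num)

lemma hasFDerivAt_fderiv (hE : ContDiff ℝ 2 E) (u : H) :
    HasFDerivAt (fderiv ℝ E) (hessian E u) u :=
  ((contDiff_one_fderiv hE).differentiable one_ne_zero u).hasFDerivAt

lemma isLittleO_taylor_two (hE : ContDiff ℝ 2 E) (u : H) :
    (fun v => E v - E u - fderiv ℝ E u (v - u) - 1 / 2 * hessian E u (v - u) (v - u))
      =o[𝓝 u] fun v => ‖v - u‖ ^ 2 := by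
  have hderiv (x : H) : HasFDerivAt
      (fun v => E v - fderiv ℝ E u (v - u) - 1 / 2 * hessian E u (v - u) (v - u))
      (fderiv ℝ E x - fderiv ℝ E u - hessian E u (x - u)) x := by
    have hid : HasFDerivAt (fun v => v - u) (.id ℝ H) x := (hasFDerivAt_id x).sub_const u
    have hquad : HasFDerivAt (fun v => hessian E u (v - u) (v - u)) (2 • hessian E u (x - u)) x :=
      (((hessian E u).hasFDerivAt.comp x hid).clm_apply hid).congr_fderiv <| by
        ext w
        simp [hessian_symm hE u w, two_mul]
    refine (((hE.differentiable two_ne_zero x).hasFDerivAt.sub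
      ((fderiv ℝ E u).hasFDerivAt.comp x hid)).sub (hquad.const_mul (1 / 2))).congr_fderiv ?_
    ext w
    simp
  have hsmall : (fun x => fderiv ℝ E x - fderiv ℝ E u - hessian E u (x - u))
      =o[𝓝[Set.univ] u] fun x => ‖x - u‖ ^ 1 := by
    simpa only [nhdsWithin_univ, pow_one] using (hasFDerivAt_fderiv hE u).isLittleO.norm_right
  have := convex_univ.isLittleO_pow_succ (Set.mem_univ u)
    (fun x _ => (hderiv x).hasFDerivWithinAt) hsmall
  refine (nhdsWithin_univ u ▸ this).congr_left fun v => ?_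
  simp only [sub_self, map_zero, mul_zero, sub_zero]
  ring

lemma IsNegDefOn.toENat_rank_le_morseIndex {V : Submodule ℝ H}
    (hV : IsNegDefOn (hessian E u) V) : Cardinal.toENat (Module.rank ℝ V) ≤ morseIndex E u :=
  le_iSup₂ (f := fun (V : Submodule ℝ H) (_ : IsNegDefOn (hessian E u) V) =>
    Cardinal.toENat (Module.rank ℝ V)) V hV

lemma morseIndex_eq_one_iff (hE : ContDiff ℝ 2 E) (hu : hessian E u u u < 0) :
    morseIndex E u = 1 ↔ ∀ v, hessian E u u v = 0 → 0 ≤ hessian E u v v := by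
  refine ⟨fun hone v huv => ?_, fun hnn => le_antisymm ?_ ?_⟩
  · by_contra! hv
    have hvu : hessian E u v u = 0 := (hessian_symm hE u v u).trans huv
    have h := (isNegDefOn_span_pair hu hv huv hvu).toENat_rank_le_morseIndex
    have : FiniteDimensional ℝ (Submodule.span ℝ {u, v}) :=
      .span_of_finite ℝ (Set.toFinite _)
    rw [← Module.finrank_eq_rank, finrank_span_pair_eq_two hu hv huv hvu, hone] at h
    norm_num at h
  · refine iSup₂_le fun V hV => ?_
    simpa using Cardinal.toENat.monotone' (hV.rank_le_one (f := (hessian E u u).toLinearMap) hnn)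
  · have hu0 : u ≠ 0 := by rintro rfl; simp at hu
    have h := (isNegDefOn_span_singleton hu).toENat_rank_le_morseIndex
    rwa [← Module.finrank_eq_rank, finrank_span_singleton hu0, Nat.cast_one, map_one] at h

lemma exists_curve_apply_eq [CompleteSpace H] {F : Type*} [NormedAddCommGroup F]
    [NormedSpace ℝ F] [FiniteDimensional ℝ F] {f : H → F} {f' : H →L[ℝ] F}
    (hf : HasStrictFDerivAt f f' u) (hf' : f'.range = ⊤) (hv : f' v = 0) :
    ∃ γ : ℝ → H, γ 0 = u ∧ HasDerivAt γ v 0 ∧ ∀ᶠ t in 𝓝 0, f (γ t) = f u := by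
  have : CompleteSpace F := FiniteDimensional.complete ℝ F
  let w : f'.ker := ⟨v, hv⟩
  let γ (t : ℝ) : H := hf.implicitFunction f f' hf' (f u) (t • w)
  have hline : HasDerivAt (fun t : ℝ => t • w) w 0 := by
    simpa using (hasDerivAt_id (0 : ℝ)).smul_const w
  refine ⟨γ, ?_, ?_, ?_⟩
  · simp [γ]
  · refine HasFDerivAt.comp_hasDerivAt_of_eq (0 : ℝ) (hf.to_implicitFunction hf').hasFDerivAt hline
      (by simp)
  · have hpair : Tendsto (fun t : ℝ => (f u, t • w)) (𝓝 0) (𝓝 (f u, (0 : f'.ker))) := by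
      refine tendsto_const_nhds.prodMk_nhds ?_
      simpa using hline.continuousAt.tendsto
    exact hpair.eventually (hf.map_implicitFunction_eq hf')

lemma tendsto_sub_div_sq_of_hasDerivAt (hE : ContDiff ℝ 2 E) (hu : IsCriticalPoint E u)
    {γ : ℝ → H} (hγ0 : γ 0 = u) (hγ : HasDerivAt γ v 0) :
    Tendsto (fun t => (E (γ t) - E u) / t ^ 2) (𝓝[≠] 0) (𝓝 (1 / 2 * hessian E u v v)) := by
  have hslope : Tendsto (fun t => t⁻¹ • (γ t - u)) (𝓝[≠] 0) (𝓝 v) := by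
    simpa [hγ0] using hγ.tendsto_slope_zero
  have hmain : Tendsto (fun t => 1 / 2 * hessian E u (t⁻¹ • (γ t - u)) (t⁻¹ • (γ t - u)))
      (𝓝[≠] 0) (𝓝 (1 / 2 * hessian E u v v)) := by
    have hc : Continuous fun w => 1 / 2 * hessian E u w w := by fun_prop
    exact (hc.tendsto v).comp hslope
  have hrem : Tendsto
      (fun t => (E (γ t) - E u - 1 / 2 * hessian E u (γ t - u) (γ t - u)) / t ^ 2)
      (𝓝[≠] 0) (𝓝 0) := by
    have hγu : Tendsto γ (𝓝 0) (𝓝 u) := hγ0 ▸ hγ.continuousAt.tendsto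
    have hbound : (fun t => ‖γ t - u‖ ^ 2) =O[𝓝 0] fun t : ℝ => t ^ 2 := by
      simpa [hγ0] using hγ.isBigO_sub.norm_left.pow 2
    have h := ((isLittleO_taylor_two hE u).comp_tendsto hγu).trans_isBigO hbound
    simpa [Function.comp_def, hu.fderiv] using (h.mono nhdsWithin_le_nhds).tendsto_div_nhds_zero
  refine (zero_add (1 / 2 * hessian E u v v) ▸ hrem.add hmain).congr' ?_
  filter_upwards [self_mem_nhdsWithin] with t (ht : t ≠ 0)
  simp only [map_smul, smul_apply, smul_eq_mul]
  field_simp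
  ring

lemma hessian_nonneg_of_isLocalMinOn [CompleteSpace H] {F : Type*} [NormedAddCommGroup F]
    [NormedSpace ℝ F] [FiniteDimensional ℝ F] {f : H → F} {f' : H →L[ℝ] F}
    (hE : ContDiff ℝ 2 E) (hu : IsCriticalPoint E u) (hf : HasStrictFDerivAt f f' u)
    (hf' : f'.range = ⊤) (hmin : IsLocalMinOn E {x | f x = f u} u) (hv : f' v = 0) :
    0 ≤ hessian E u v v := by
  obtain ⟨γ, hγ0, hγ, hfγ⟩ := exists_curve_apply_eq hf hf' hv
  have hγu : Tendsto γ (𝓝 0) (𝓝[{x | f x = f u}] u) :=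
    tendsto_nhdsWithin_iff.2 ⟨hγ0 ▸ hγ.continuousAt.tendsto, hfγ⟩
  have hquot : ∀ᶠ t in 𝓝[≠] 0, 0 ≤ (E (γ t) - E u) / t ^ 2 := by
    filter_upwards [(hγu.mono_left nhdsWithin_le_nhds).eventually hmin] with t ht
    exact div_nonneg (sub_nonneg.2 ht) (sq_nonneg t)
  linarith [ge_of_tendsto (tendsto_sub_div_sq_of_hasDerivAt hE hu hγ0 hγ) hquot]

/-- The function `v ↦ ⟨E'(v), v⟩`, whose zero set away from the origin is the Nehari manifold. -/
noncomputable def nehariConstraint (E : H → ℝ) (v : H) : ℝ := fderiv ℝ E v v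

lemma hasStrictFDerivAt_nehariConstraint (hE : ContDiff ℝ 2 E) (u : H) :
    HasStrictFDerivAt (nehariConstraint E) (hessian E u u + fderiv ℝ E u) u := by
  have hderiv : HasFDerivAt (nehariConstraint E) (hessian E u u + fderiv ℝ E u) u := by
    refine ((hasFDerivAt_fderiv hE u).clm_apply (hasFDerivAt_id u)).congr_fderiv ?_
    ext v
    simp [hessian_symm hE u v u, add_comm]
  have hC : ContDiff ℝ 1 (nehariConstraint E) := (contDiff_one_fderiv hE).clm_apply contDiff_id
  exact hC.contDiffAt.hasStrictFDerivAt' hderiv one_ne_zero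

lemma isLocalMinOn_nehariConstraint (hu : u ∈ nehari E) (hmin : IsLocalMinOn E (nehari E) u) :
    IsLocalMinOn E {v | nehariConstraint E v = nehariConstraint E u} u := by
  refine eventually_nhdsWithin_iff.2 ?_
  filter_upwards [eventually_nhdsWithin_iff.1 hmin, isOpen_ne.mem_nhds hu.1] with v hv hv0 hvJ
  exact hv ⟨hv0, hvJ.trans hu.2⟩

lemma isCriticalPoint_of_isLocalMinOn_nehari [CompleteSpace H] (hE : ContDiff ℝ 2 E)
    (hu : u ∈ nehari E) (hneg : hessian E u u u < 0) (hmin : IsLocalMinOn E (nehari E) u) :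
    IsCriticalPoint E u := by
  have hEu : HasStrictFDerivAt E (fderiv ℝ E u) u := hE.contDiffAt.hasStrictFDerivAt two_ne_zero
  have hext : IsLocalExtrOn E {v | nehariConstraint E v = nehariConstraint E u} u :=
    .inl (isLocalMinOn_nehariConstraint hu hmin)
  obtain ⟨a, b, hab, hsum⟩ := hext.exists_multipliers_of_hasStrictFDerivAt_1d
    (hasStrictFDerivAt_nehariConstraint hE u) hEu
  have ha : a = 0 := by
    have := DFunLike.congr_fun hsum u
    simpa [show fderiv ℝ E u u = 0 from hu.2, hneg.ne] using this
  have hb : b ≠ 0 := fun hb => hab (by simp [ha, hb])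
  have hzero : fderiv ℝ E u = 0 := by simpa [ha, hb] using hsum
  rw [hzero] at hEu
  exact hEu.hasFDerivAt

theorem IsLocalMinimizerOn.isOneSaddle [CompleteSpace H] (hE : ContDiff ℝ 2 E)
    (hneg : hessian E u u u < 0) (hu : IsLocalMinimizerOn E (nehari E) u) : IsOneSaddle E u := by
  have hcrit := isCriticalPoint_of_isLocalMinOn_nehari hE hu.1 hneg hu.2
  refine ⟨hcrit, (morseIndex_eq_one_iff hE hneg).2 fun v hv => ?_⟩
  have hJ := hasStrictFDerivAt_nehariConstraint hE u
  rw [hcrit.fderiv, add_zero] at hJ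
  have hrange : (hessian E u u).range = ⊤ :=
    LinearMap.range_eq_top.2 <| LinearMap.surjective fun h => hneg.ne (DFunLike.congr_fun h u)
  exact hessian_nonneg_of_isLocalMinOn hE hcrit hJ hrange
    (isLocalMinOn_nehariConstraint hu.1 hu.2) hv

lemma isLittleO_hessian_nehari (hE : ContDiff ℝ 2 E) (hu : IsCriticalPoint E u) :
    (fun v => hessian E u u (v - u)) =o[𝓝[nehari E] u] fun v => ‖v - u‖ := by
  have hJ := (hasStrictFDerivAt_nehariConstraint hE u).hasFDerivAt.isLittleO
  refine (hJ.mono nhdsWithin_le_nhds).norm_right.neg_left.congr' ?_ .rfl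
  filter_upwards [self_mem_nhdsWithin] with v hv
  simp [nehariConstraint, hu.fderiv, show fderiv ℝ E v v = 0 from hv.2]

lemma isLittleO_reflectedForm_nehari (hE : ContDiff ℝ 2 E) (hu : IsCriticalPoint E u) :
    (fun v => E v - E u - 1 / 2 * reflectedForm (hessian E u) u (v - u) (v - u))
      =o[𝓝[nehari E] u] fun v => ‖v - u‖ ^ 2 := by
  have hsq := ((isLittleO_hessian_nehari hE hu).pow two_pos).const_mul_left (1 / hessian E u u u)
  refine (((isLittleO_taylor_two hE u).mono nhdsWithin_le_nhds).add hsq).congr_left fun v => ?_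
  simp only [hu.fderiv, reflectedForm_apply, zero_apply]
  ring

theorem IsOneSaddle.isStrictLocalMinimizerOn (hE : ContDiff ℝ 2 E) (hneg : hessian E u u u < 0)
    (hu : IsOneSaddle E u) (hnd : IsNondegenerate E u) :
    IsStrictLocalMinimizerOn E (nehari E) u := by
  have hu0 : u ≠ 0 := by rintro rfl; simp at hneg
  refine ⟨⟨hu0, by simp [hu.1.fderiv]⟩, ?_⟩
  obtain ⟨C, hC, hcoer⟩ := isCoercive_reflectedForm (hessian_symm hE u) hnd hneg
    ((morseIndex_eq_one_iff hE hneg).1 hu.2)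
  filter_upwards [(isLittleO_reflectedForm_nehari hE hu.1).def (show 0 < C / 4 by positivity)]
    with v hv hvu
  have hpos : 0 < C * ‖v - u‖ * ‖v - u‖ := by
    have := norm_pos_iff.2 (sub_ne_zero.2 hvu)
    positivity
  rw [Real.norm_eq_abs, norm_pow, norm_norm] at hv
  linarith [(abs_le.1 hv).1, hcoer (v - u)]

lemma hasDerivAt_ray (u : H) (t : ℝ) : HasDerivAt (fun t : ℝ => t • u) u t := by
  simpa using (hasDerivAt_id t).smul_const u

lemma hasDerivAt_apply_ray {t : ℝ} (hE : DifferentiableAt ℝ E (t • u)) :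
    HasDerivAt (fun t : ℝ => E (t • u)) (fderiv ℝ E (t • u) u) t :=
  hE.hasFDerivAt.comp_hasDerivAt t (hasDerivAt_ray u t)

lemma hasDerivAt_fderiv_ray (hE : ContDiff ℝ 2 E) (u : H) (t : ℝ) :
    HasDerivAt (fun t : ℝ => fderiv ℝ E (t • u) u) (hessian E (t • u) u u) t := by
  have h : HasDerivAt (fun t : ℝ => fderiv ℝ E (t • u)) (hessian E (t • u) u) t :=
    (hasFDerivAt_fderiv hE (t • u)).comp_hasDerivAt t (hasDerivAt_ray u t)
  simpa using h.clm_apply (hasDerivAt_const t u)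

section Ray

variable {q r : ℝ}

lemma fderiv_smul_apply_of_ray (hE : Differentiable ℝ E)
    (hray : ∀ t : ℝ, E (t • u) = 1 / 2 * (t ^ 2 * q) - 1 / 4 * (t ^ 4 * r)) (t : ℝ) :
    fderiv ℝ E (t • u) u = t * q - t ^ 3 * r := by
  have h := hasDerivAt_apply_ray (hE (t • u))
  rw [funext hray] at h
  have hpoly : HasDerivAt (fun t : ℝ => 1 / 2 * (t ^ 2 * q) - 1 / 4 * (t ^ 4 * r))
      (1 / 2 * ((2 : ℕ) * t ^ 1 * q) - 1 / 4 * ((4 : ℕ) * t ^ 3 * r)) t :=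
    (((hasDerivAt_pow 2 t).mul_const q).const_mul _).sub
      (((hasDerivAt_pow 4 t).mul_const r).const_mul _)
  rw [h.unique hpoly]
  push_cast
  ring

lemma hessian_self_of_ray (hE : ContDiff ℝ 2 E)
    (hray : ∀ t : ℝ, E (t • u) = 1 / 2 * (t ^ 2 * q) - 1 / 4 * (t ^ 4 * r)) :
    hessian E u u u = q - 3 * r := by
  have h := hasDerivAt_fderiv_ray hE u 1
  rw [funext (fderiv_smul_apply_of_ray (hE.differentiable two_ne_zero) hray), one_smul] at h
  have hpoly : HasDerivAt (fun t : ℝ => t * q - t ^ 3 * r) (1 * q - (3 : ℕ) * 1 ^ 2 * r) 1 :=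
    ((hasDerivAt_id 1).mul_const q).sub ((hasDerivAt_pow 3 1).mul_const r)
  rw [h.unique hpoly]
  norm_num

end Ray

end NehariManifold

section Sobolev

open scoped ENNReal NNReal

section Lp

variable {α F W : Type*} {mα : MeasurableSpace α} {μ : Measure α} [NormedAddCommGroup F]
  {p q : ℝ≥0∞}

lemma exists_eLpNorm_le_of_support_subset {s : Set α} (hs : μ s ≠ ⊤) (hp : p ≠ 0) (hpq : p ≤ q) :
    ∃ C : ℝ≥0, ∀ f : α → F, AEStronglyMeasurable f μ → f.support ⊆ s →
      eLpNorm f p μ ≤ C * eLpNorm f q μ := by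
  have hexp : 0 ≤ 1 / p.toReal - 1 / q.toReal := by
    simp only [one_div, ← ENNReal.toReal_inv, sub_nonneg]
    exact ENNReal.toReal_mono (ENNReal.inv_ne_top.2 hp) (ENNReal.inv_le_inv.2 hpq)
  have hC := ENNReal.rpow_ne_top_of_nonneg hexp hs
  refine ⟨(μ s ^ (1 / p.toReal - 1 / q.toReal)).toNNReal, fun f hf hfs => ?_⟩
  calc eLpNorm f p μ = eLpNorm f p (μ.restrict s) :=
        (eLpNorm_restrict_eq_of_support_subset hfs).symm
    _ ≤ eLpNorm f q (μ.restrict s) * μ s ^ (1 / p.toReal - 1 / q.toReal) := by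
        simpa only [Measure.restrict_apply_univ] using
          eLpNorm_le_eLpNorm_mul_rpow_measure_univ hpq hf.restrict
    _ = _ := by
        rw [eLpNorm_restrict_eq_of_support_subset hfs, ENNReal.coe_toNNReal hC, mul_comm]

lemma eLpNorm_le_of_tendsto_Lp [Fact (1 ≤ p)] {f : ℕ → Lp F p μ} {g : Lp F p μ}
    (hfg : Tendsto f atTop (𝓝 g)) {c : ℕ → ℝ≥0∞} {C : ℝ≥0∞} (hc : Tendsto c atTop (𝓝 C))
    (hfc : ∀ n, eLpNorm (f n) q μ ≤ c n) : eLpNorm g q μ ≤ C := by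
  obtain ⟨ns, hns, hae⟩ := (tendstoInMeasure_of_tendsto_Lp hfg).exists_seq_tendsto_ae
  calc eLpNorm g q μ ≤ liminf (fun n => eLpNorm (f (ns n)) q μ) atTop :=
        Lp.eLpNorm_lim_le_liminf_eLpNorm (fun n => Lp.aestronglyMeasurable (f (ns n))) _ hae
    _ ≤ liminf (fun n => c (ns n)) atTop := liminf_le_liminf (.of_forall fun n => hfc (ns n))
    _ = C := (hc.comp hns.tendsto_atTop).liminf_eq

variable [NormedSpace ℝ F] [NormedAddCommGroup W] [NormedSpace ℝ W] [Fact (1 ≤ p)]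
  {C : ℝ≥0}

lemma eLpNorm_le_of_mem_closure {S : W →L[ℝ] Lp F p μ} {K : Set W}
    (hS : ∀ w ∈ K, eLpNorm (S w) q μ ≤ C * ‖w‖ₑ) {w : W} (hw : w ∈ closure K) :
    eLpNorm (S w) q μ ≤ C * ‖w‖ₑ := by
  obtain ⟨x, hxK, hxw⟩ := mem_closure_iff_seq_limit.1 hw
  have hbound : Tendsto (fun n => C * ‖x n‖ₑ) atTop (𝓝 (C * ‖w‖ₑ)) :=
    ENNReal.Tendsto.const_mul hxw.enorm (.inr ENNReal.coe_ne_top)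
  exact eLpNorm_le_of_tendsto_Lp ((S.continuous.tendsto w).comp hxw) hbound
    fun n => hS (x n) (hxK n)

lemma exists_continuousLinearMap_Lp_ae_eq [Fact (1 ≤ q)] {S : W →L[ℝ] Lp F p μ}
    (hS : ∀ w, eLpNorm (S w) q μ ≤ C * ‖w‖ₑ) :
    ∃ T : W →L[ℝ] Lp F q μ, ∀ w, T w =ᵐ[μ] S w := by
  have hmem (w : W) : MemLp (S w) q μ :=
    ⟨Lp.aestronglyMeasurable _, (hS w).trans_lt (by finiteness)⟩
  let T₀ : W →ₗ[ℝ] Lp F q μ :=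
    { toFun w := (hmem w).toLp
      map_add' v w := by
        rw [← MemLp.toLp_add]
        exact MemLp.toLp_congr _ _ (map_add S v w ▸ Lp.coeFn_add (S v) (S w))
      map_smul' c w := by
        rw [RingHom.id_apply, ← MemLp.toLp_const_smul]
        exact MemLp.toLp_congr _ _ (map_smul S c w ▸ Lp.coeFn_smul c (S w)) }
  refine ⟨T₀.mkContinuous C fun w => ?_, fun w => (hmem w).coeFn_toLp⟩
  simpa [T₀, Lp.norm_toLp] using ENNReal.toReal_mono (by finiteness) (hS w)

end Lp

section EuclideanSpace

variable {V F : Type*} [NormedAddCommGroup V] [InnerProductSpace ℝ V] [FiniteDimensional ℝ V]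
  [MeasurableSpace V] [BorelSpace V] [NormedAddCommGroup F] [NormedSpace ℝ F] {s : Set V}

lemma enorm_le_eLpNorm_fderiv_one (hV : Module.finrank ℝ V = 1) {u : V → F}
    (hu : ContDiff ℝ 1 u) (hu' : HasCompactSupport u) (x : V) :
    ‖u x‖ₑ ≤ eLpNorm (fderiv ℝ u) 1 volume := by
  let L : ℝ ≃ₗᵢ[ℝ] V := (OrthonormalBasis.singleton (Fin 1) ℝ).equiv
    ((stdOrthonormalBasis ℝ V).reindex (finCongr hV)) (.refl _)
  have huL : HasCompactSupport (u ∘ L) := hu'.comp_homeomorph L.toHomeomorph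
  have hderiv (t : ℝ) : ‖deriv (u ∘ L) t‖ₑ ≤ ‖fderiv ℝ u (L t)‖ₑ := by
    have h : HasDerivAt (u ∘ L) (fderiv ℝ u (L t) (L 1)) t :=
      (hu.differentiable one_ne_zero (L t)).hasFDerivAt.comp_hasDerivAt t
        (by simpa using (L : ℝ →L[ℝ] V).hasDerivAt (x := t))
    rw [h.deriv]
    simpa [← enorm_norm (L 1)] using (fderiv ℝ u (L t)).le_opENorm (L 1)
  calc ‖u x‖ₑ = ‖(u ∘ L) (L.symm x)‖ₑ := by simp
    _ ≤ ∫⁻ t in Set.Iic (L.symm x), ‖deriv (u ∘ L) t‖ₑ :=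
      huL.enorm_le_lintegral_Ici_deriv (hu.comp L.contDiff) _
    _ ≤ ∫⁻ t, ‖deriv (u ∘ L) t‖ₑ := setLIntegral_le_lintegral _ _
    _ ≤ ∫⁻ t, ‖fderiv ℝ u (L t)‖ₑ := lintegral_mono hderiv
    _ = ∫⁻ y, ‖fderiv ℝ u y‖ₑ :=
      L.measurePreserving.lintegral_comp_emb L.toHomeomorph.measurableEmbedding
        fun y => ‖fderiv ℝ u y‖ₑ
    _ = eLpNorm (fderiv ℝ u) 1 volume := eLpNorm_one_eq_lintegral_enorm.symm

lemma exists_eLpNorm_fderiv_le (hs : Bornology.IsBounded s) {p r : ℝ≥0∞} (hp : p ≠ 0)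
    (hpr : p ≤ r) : ∃ C : ℝ≥0, ∀ u : V → F, ContDiff ℝ 1 u → u.support ⊆ s →
      eLpNorm (fderiv ℝ u) p volume ≤ C * eLpNorm (fderiv ℝ u) r volume := by
  obtain ⟨C, hC⟩ := exists_eLpNorm_le_of_support_subset (μ := (volume : Measure V))
    (F := V →L[ℝ] F) hs.closure.measure_lt_top.ne hp hpr
  exact ⟨C, fun u hu hus => hC _ (hu.continuous_fderiv one_ne_zero).aestronglyMeasurable
    ((support_fderiv_subset ℝ).trans (closure_mono hus))⟩

lemma exists_eLpNorm_le_eLpNorm_fderiv_of_finrank_eq_one (hV : Module.finrank ℝ V = 1)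
    (hs : Bornology.IsBounded s) (q : ℝ≥0∞) {r : ℝ≥0∞} (hr : 1 ≤ r) :
    ∃ C : ℝ≥0, ∀ u : V → F, ContDiff ℝ 1 u → u.support ⊆ s →
      eLpNorm u q volume ≤ C * eLpNorm (fderiv ℝ u) r volume := by
  obtain ⟨C, hC⟩ := exists_eLpNorm_fderiv_le (F := F) hs one_ne_zero hr
  have hvol : volume s ^ q.toReal⁻¹ ≠ ⊤ :=
    ENNReal.rpow_ne_top_of_nonneg (by positivity) hs.measure_lt_top.ne
  refine ⟨(volume s ^ q.toReal⁻¹).toNNReal * C, fun u hu hus => ?_⟩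
  have hcs : HasCompactSupport u :=
    .of_support_subset_isCompact hs.isCompact_closure (hus.trans subset_closure)
  calc eLpNorm u q volume = eLpNorm u q (volume.restrict s) :=
        (eLpNorm_restrict_eq_of_support_subset hus).symm
    _ ≤ eLpNorm (fderiv ℝ u) 1 volume * volume s ^ q.toReal⁻¹ := by
        simpa using eLpNorm_le_of_ae_enorm_bound (p := q) (μ := volume.restrict s)
          (ae_of_all _ fun x => enorm_le_eLpNorm_fderiv_one hV hu hcs x)
    _ ≤ C * eLpNorm (fderiv ℝ u) r volume * volume s ^ q.toReal⁻¹ := by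
        gcongr
        exact hC u hu hus
    _ = _ := by rw [ENNReal.coe_mul, ENNReal.coe_toNNReal hvol]; ring

lemma exists_eLpNorm_le_eLpNorm_fderiv_of_lt_finrank [FiniteDimensional ℝ F]
    (hs : Bornology.IsBounded s) {p q : ℝ≥0} {r : ℝ≥0∞} (hp : 1 ≤ p) (hpr : p ≤ r)
    (hpV : p < Module.finrank ℝ V) (hpq : (p : ℝ)⁻¹ - (Module.finrank ℝ V : ℝ)⁻¹ ≤ (q : ℝ)⁻¹) :
    ∃ C : ℝ≥0, ∀ u : V → F, ContDiff ℝ 1 u → u.support ⊆ s →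
      eLpNorm u q volume ≤ C * eLpNorm (fderiv ℝ u) r volume := by
  have hp0 : (p : ℝ≥0∞) ≠ 0 := by exact_mod_cast (one_pos.trans_le hp).ne'
  obtain ⟨C, hC⟩ := exists_eLpNorm_fderiv_le (F := F) hs hp0 hpr
  refine ⟨eLpNormLESNormFDerivOfLeConst F (volume : Measure V) s p q * C, fun u hu hus => ?_⟩
  rw [ENNReal.coe_mul, mul_assoc]
  exact (eLpNorm_le_eLpNorm_fderiv_of_le volume hu hus hp hpV hpq hs).trans
    (by gcongr; exact hC u hu hus)

lemma exists_eLpNorm_four_le_eLpNorm_fderiv_two [FiniteDimensional ℝ F]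
    (hV1 : 1 ≤ Module.finrank ℝ V) (hV4 : Module.finrank ℝ V ≤ 4) (hs : Bornology.IsBounded s) :
    ∃ C : ℝ≥0, ∀ u : V → F, ContDiff ℝ 1 u → u.support ⊆ s →
      eLpNorm u 4 volume ≤ C * eLpNorm (fderiv ℝ u) 2 volume := by
  obtain h1 | h2 | h3 : Module.finrank ℝ V = 1 ∨ Module.finrank ℝ V = 2 ∨
      3 ≤ Module.finrank ℝ V := by omega
  · exact exists_eLpNorm_le_eLpNorm_fderiv_of_finrank_eq_one h1 hs 4 one_le_two
  · have h43 : (4 / 3 : ℝ≥0) ≤ 2 := by rw [← NNReal.coe_le_coe]; norm_num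
    refine exists_eLpNorm_le_eLpNorm_fderiv_of_lt_finrank (p := 4 / 3) (q := 4) hs ?_
      (by exact_mod_cast h43) ?_ ?_
    · rw [← NNReal.coe_le_coe]; norm_num
    · rw [h2, ← NNReal.coe_lt_coe]; norm_num
    · rw [h2]; norm_num
  · refine exists_eLpNorm_le_eLpNorm_fderiv_of_lt_finrank (p := 2) (q := 4) hs one_le_two
      (by norm_num) (by exact_mod_cast h3) ?_
    have : (4 : ℝ)⁻¹ ≤ (Module.finrank ℝ V : ℝ)⁻¹ := by
      gcongr
      exact_mod_cast hV4
    push_cast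
    linarith

end EuclideanSpace

section H01

variable {N : ℕ} {Ω : Set (Eucl N)}

instance fact_one_le_four : Fact ((1 : ℝ≥0∞) ≤ 4) := ⟨by norm_num⟩

lemma IsTestFunction.eLpNorm_fderiv {φ : Eucl N → ℝ} (hφ : IsTestFunction Ω φ) (p : ℝ≥0∞) :
    eLpNorm (fderiv ℝ φ) p volume = eLpNorm (∇ φ) p (volume.restrict Ω) := by
  have hsupp : (fderiv ℝ φ).support ⊆ Ω := (support_fderiv_subset ℝ).trans hφ.tsupport_subset
  rw [← eLpNorm_restrict_eq_of_support_subset (f := fderiv ℝ φ) hsupp]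
  exact eLpNorm_congr_norm_ae (ae_of_all _ fun x => by simp [gradient])

lemma exists_eLpNorm_fst_four_le (hN1 : 1 ≤ N) (hN4 : N ≤ 4) (hΩ : Bornology.IsBounded Ω) :
    ∃ C : ℝ≥0, ∀ w ∈ testGraph Ω, eLpNorm w.fst 4 (volume.restrict Ω) ≤ C * ‖w‖ₑ := by
  obtain ⟨C, hC⟩ := exists_eLpNorm_four_le_eLpNorm_fderiv_two (V := Eucl N) (F := ℝ)
    (by simpa using hN1) (by simpa using hN4) hΩ
  refine ⟨C, fun w ⟨φ, hφ, hfst, hsnd⟩ => ?_⟩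
  calc eLpNorm w.fst 4 (volume.restrict Ω) = eLpNorm φ 4 (volume.restrict Ω) :=
        eLpNorm_congr_ae hfst
    _ ≤ eLpNorm φ 4 volume := eLpNorm_mono_measure φ Measure.restrict_le_self
    _ ≤ C * eLpNorm (fderiv ℝ φ) 2 volume :=
        hC φ (hφ.contDiff.of_le (by simp)) ((subset_tsupport φ).trans hφ.tsupport_subset)
    _ = C * ‖w.snd‖ₑ := by rw [hφ.eLpNorm_fderiv, ← eLpNorm_congr_ae hsnd, Lp.enorm_def]
    _ ≤ C * ‖w‖ₑ := by
        gcongr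
        exact enorm_le_iff_norm_le.2 (WithLp.norm_snd_le _ w)

/-- The inclusion of `H_0^1(Ω)` in `L²(Ω)`, as a continuous linear map. -/
noncomputable def fnL (Ω : Set (Eucl N)) : H01 Ω →L[ℝ] Lp ℝ 2 (volume.restrict Ω) :=
  WithLp.fstL 2 ℝ _ _ ∘L (H01 Ω).subtypeL

/-- The weak gradient on `H_0^1(Ω)`, as a continuous linear map. -/
noncomputable def gradL (Ω : Set (Eucl N)) : H01 Ω →L[ℝ] Lp (Eucl N) 2 (volume.restrict Ω) :=
  WithLp.sndL 2 ℝ _ _ ∘L (H01 Ω).subtypeL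

theorem exists_sobolevEmbedding (hN1 : 1 ≤ N) (hN4 : N ≤ 4) (hΩ : Bornology.IsBounded Ω) :
    ∃ T : H01 Ω →L[ℝ] Lp ℝ 4 (volume.restrict Ω), ∀ u, T u =ᵐ[volume.restrict Ω] fn u := by
  obtain ⟨C, hC⟩ := exists_eLpNorm_fst_four_le hN1 hN4 hΩ
  let S : L2Pair Ω →L[ℝ] Lp ℝ 2 (volume.restrict Ω) := WithLp.fstL 2 ℝ _ _
  have hbound (u : H01 Ω) : eLpNorm (fnL Ω u) 4 (volume.restrict Ω) ≤ C * ‖u‖ₑ :=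
    eLpNorm_le_of_mem_closure (S := S) (K := testGraph Ω) hC u.2
  exact exists_continuousLinearMap_Lp_ae_eq hbound

end H01

end Sobolev

section Energy

open scoped ENNReal RealInnerProductSpace

section Lp

variable {α : Type*} {mα : MeasurableSpace α} {μ : Measure α} {n : WithTop ℕ∞}

instance holderTriple_four_four_two : ENNReal.HolderTriple 4 4 2 where
  inv_add_inv_eq_inv := by
    rw [show (4 : ℝ≥0∞) = 2 * 2 by norm_num, ENNReal.mul_inv (by simp) (by simp), ← mul_add,
      ENNReal.inv_two_add_inv_two, mul_one]

lemma integrable_mul_sq {b : α → ℝ} (hb : MemLp b ⊤ μ) (f : Lp ℝ 2 μ) :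
    Integrable (fun x => b x * f x ^ 2) μ :=
  (Lp.memLp f).integrable_sq.mul_of_top_right hb

lemma contDiff_integral_mul_sq {b : α → ℝ} (hb : MemLp b ⊤ μ) :
    ContDiff ℝ n fun f : Lp ℝ 2 μ => ∫ x, b x * f x ^ 2 ∂μ := by
  let B := ContinuousLinearMap.mul ℝ ℝ
  let M : Lp ℝ 2 μ →L[ℝ] Lp ℝ 2 μ := B.holderL μ ⊤ 2 2 (hb.toLp b)
  have hM (f : Lp ℝ 2 μ) : ∫ x, b x * f x ^ 2 ∂μ = ⟪f, M f⟫ := by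
    rw [L2.inner_def]
    refine integral_congr_ae ?_
    filter_upwards [B.coeFn_holder (r := 2) (hb.toLp b) f, hb.coeFn_toLp] with x hMx hbx
    rw [show M f x = b x * f x by rw [← hbx]; exact hMx,
      RCLike.inner_apply, conj_trivial]
    ring
  rw [funext hM]
  exact contDiff_id.inner ℝ M.contDiff

lemma integrable_sq_mul_sq (f h : Lp ℝ 4 μ) : Integrable (fun x => f x ^ 2 * h x ^ 2) μ := by
  have hsq (f : Lp ℝ 4 μ) : MemLp (fun x => f x ^ 2) 2 μ := by
    simpa only [sq] using (Lp.memLp f).mul' (Lp.memLp f)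
  exact (hsq f).integrable_mul (hsq h)

lemma contDiff_integral_sq_mul_sq :
    ContDiff ℝ n fun p : Lp ℝ 4 μ × Lp ℝ 4 μ => ∫ x, p.1 x ^ 2 * p.2 x ^ 2 ∂μ := by
  let B := ContinuousLinearMap.mul ℝ ℝ
  let M : Lp ℝ 4 μ →L[ℝ] Lp ℝ 4 μ →L[ℝ] Lp ℝ 2 μ := B.holderL μ 4 4 2
  have hM (f h : Lp ℝ 4 μ) : ∫ x, f x ^ 2 * h x ^ 2 ∂μ = ⟪M f f, M h h⟫ := by
    rw [L2.inner_def]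
    refine integral_congr_ae ?_
    filter_upwards [B.coeFn_holder (r := 2) f f, B.coeFn_holder (r := 2) h h] with x hf hh
    rw [show M f f x = f x * f x from hf, show M h h x = h x * h x from hh,
      RCLike.inner_apply, conj_trivial]
    ring
  have hsq : ContDiff ℝ n fun f => M f f := M.contDiff.clm_apply contDiff_id
  rw [show (fun p : Lp ℝ 4 μ × Lp ℝ 4 μ => ∫ x, p.1 x ^ 2 * p.2 x ^ 2 ∂μ) =
    fun p => ⟪M p.1 p.1, M p.2 p.2⟫ from funext fun p => hM p.1 p.2]
  exact (hsq.comp contDiff_fst).inner ℝ (hsq.comp contDiff_snd)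

end Lp

section Copositive

variable {ι : Type*} [Fintype ι] {g : Matrix ι ι ℝ}

/-- A real matrix is strictly copositive if its quadratic form is positive at every nonzero vector
with nonnegative entries. -/
def IsStrictlyCopositive (g : Matrix ι ι ℝ) : Prop :=
  ∀ y : ι → ℝ, 0 ≤ y → y ≠ 0 → 0 < ∑ i, ∑ j, g i j * y i * y j

lemma isStrictlyCopositive_of_pos (hg : ∀ i j, 0 < g i j) : IsStrictlyCopositive g := by
  intro y hy hy0
  obtain ⟨k, hk⟩ := Function.ne_iff.1 hy0
  have hterm (i j : ι) : 0 ≤ g i j * y i * y j :=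
    mul_nonneg (mul_nonneg (hg i j).le (hy i)) (hy j)
  have hkk : 0 < g k k * y k * y k := by
    rw [mul_assoc]
    exact mul_pos (hg k k) (mul_self_pos.2 hk)
  refine Finset.sum_pos' (fun i _ => Finset.sum_nonneg fun j _ => hterm i j)
    ⟨k, Finset.mem_univ k, ?_⟩
  exact Finset.sum_pos' (fun j _ => hterm k j) ⟨k, Finset.mem_univ k, hkk⟩

lemma isStrictlyCopositive_of_posDef (hg : g.PosDef) : IsStrictlyCopositive g := by
  intro y _ hy0
  have hsum : ∑ i, ∑ j, g i j * y i * y j = star y ⬝ᵥ g.mulVec y := by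
    simp only [dotProduct, Matrix.mulVec, Finset.mul_sum, star_trivial]
    exact Finset.sum_congr rfl fun i _ => Finset.sum_congr rfl fun j _ => by ring
  exact hsum ▸ hg.dotProduct_mulVec_pos hy0

lemma IsStrictlyCopositive.nonneg (hg : IsStrictlyCopositive g) {y : ι → ℝ} (hy : 0 ≤ y) :
    0 ≤ ∑ i, ∑ j, g i j * y i * y j := by
  rcases eq_or_ne y 0 with rfl | hy0
  · simp
  · exact (hg y hy hy0).le

end Copositive

variable {N m : ℕ} {Ω : Set (Eucl N)} {ε : Fin m → ℝ} {a : Fin m → Eucl N → ℝ}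
  {g : Matrix (Fin m) (Fin m) ℝ} {T : H01 Ω →L[ℝ] Lp ℝ 4 (volume.restrict Ω)} {n : WithTop ℕ∞}

-- A shortcut: the search for this instance times out in some of the proofs below.
noncomputable local instance normedSpaceHSpace : NormedSpace ℝ (HSpace Ω m) :=
  PiLp.normedSpace 2 ℝ fun _ => H01 Ω

/-- The quadratic functional `∫_Ω ∑ᵢ (εᵢ |∇uᵢ|² + aᵢ uᵢ²)` in the energy. -/
noncomputable def quadraticPart (Ω : Set (Eucl N)) (ε : Fin m → ℝ) (a : Fin m → Eucl N → ℝ)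
    (u : HSpace Ω m) : ℝ :=
  ∫ x in Ω, ∑ i, (ε i * ‖grad (u i) x‖ ^ 2 + a i x * fn (u i) x ^ 2)

/-- The quartic functional `∫_Ω ∑ᵢⱼ gᵢⱼ uᵢ² uⱼ²` in the energy. -/
noncomputable def quarticPart (Ω : Set (Eucl N)) (g : Matrix (Fin m) (Fin m) ℝ)
    (u : HSpace Ω m) : ℝ :=
  ∫ x in Ω, ∑ i, ∑ j, g i j * fn (u i) x ^ 2 * fn (u j) x ^ 2

lemma quadraticPart_smul (t : ℝ) (u : HSpace Ω m) :
    quadraticPart Ω ε a (t • u) = t ^ 2 * quadraticPart Ω ε a u := by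
  have hfn : ∀ᵐ x ∂volume.restrict Ω, ∀ i, fn ((t • u) i) x = t * fn (u i) x :=
    ae_all_iff.2 fun i => Lp.coeFn_smul t (fn (u i))
  have hgrad : ∀ᵐ x ∂volume.restrict Ω, ∀ i, grad ((t • u) i) x = t • grad (u i) x :=
    ae_all_iff.2 fun i => Lp.coeFn_smul t (grad (u i))
  rw [quadraticPart, quadraticPart, ← integral_const_mul]
  refine integral_congr_ae ?_
  filter_upwards [hfn, hgrad] with x hfnx hgradx
  rw [Finset.mul_sum]
  refine Finset.sum_congr rfl fun i _ => ?_
  rw [hfnx, hgradx, norm_smul, mul_pow, Real.norm_eq_abs, sq_abs]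
  ring

lemma quarticPart_smul (t : ℝ) (u : HSpace Ω m) :
    quarticPart Ω g (t • u) = t ^ 4 * quarticPart Ω g u := by
  have hfn : ∀ᵐ x ∂volume.restrict Ω, ∀ i, fn ((t • u) i) x = t * fn (u i) x :=
    ae_all_iff.2 fun i => Lp.coeFn_smul t (fn (u i))
  rw [quarticPart, quarticPart, ← integral_const_mul]
  refine integral_congr_ae ?_
  filter_upwards [hfn] with x hfnx
  simp only [hfnx, Finset.mul_sum]
  exact Finset.sum_congr rfl fun i _ => Finset.sum_congr rfl fun j _ => by ring

lemma energy_smul (t : ℝ) (u : HSpace Ω m) :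
    energy Ω ε a g (t • u) =
      1 / 2 * (t ^ 2 * quadraticPart Ω ε a u) - 1 / 4 * (t ^ 4 * quarticPart Ω g u) := by
  rw [← quadraticPart_smul, ← quarticPart_smul]
  rfl

lemma quadraticPart_eq_sum (ha : ∀ i, MemLp (a i) ⊤ (volume.restrict Ω)) (u : HSpace Ω m) :
    quadraticPart Ω ε a u =
      ∑ i, (ε i * ‖grad (u i)‖ ^ 2 + ∫ x in Ω, a i x * fn (u i) x ^ 2) := by
  have hgrad (i : Fin m) :
      Integrable (fun x => ε i * ‖grad (u i) x‖ ^ 2) (volume.restrict Ω) :=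
    ((Lp.memLp (grad (u i))).integrable_norm_pow two_ne_zero).const_mul (ε i)
  have hnorm (i : Fin m) : ∫ x in Ω, ‖grad (u i) x‖ ^ 2 = ‖grad (u i)‖ ^ 2 := by
    simp only [← real_inner_self_eq_norm_sq, L2.inner_def]
  have hfn (i : Fin m) := integrable_mul_sq (ha i) (fn (u i))
  rw [quadraticPart, integral_finsetSum _ fun i _ => (hgrad i).fun_add (hfn i)]
  refine Finset.sum_congr rfl fun i _ => ?_
  rw [integral_add (hgrad i) (hfn i), integral_const_mul, hnorm]

lemma contDiff_quadraticPart (ha : ∀ i, MemLp (a i) ⊤ (volume.restrict Ω)) :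
    ContDiff ℝ n (quadraticPart Ω ε a) := by
  rw [funext (quadraticPart_eq_sum ha)]
  refine ContDiff.sum fun i _ => ?_
  let π : HSpace Ω m →L[ℝ] H01 Ω := PiLp.proj 2 _ i
  exact (contDiff_const.mul ((gradL Ω ∘L π).contDiff.norm_sq ℝ)).add
    ((contDiff_integral_mul_sq (ha i)).comp (fnL Ω ∘L π).contDiff)

lemma integrable_fn_sq_mul_fn_sq (hT : ∀ u, T u =ᵐ[volume.restrict Ω] fn u) (v w : H01 Ω) :
    Integrable (fun x => fn v x ^ 2 * fn w x ^ 2) (volume.restrict Ω) := by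
  refine (integrable_sq_mul_sq (T v) (T w)).congr ?_
  filter_upwards [hT v, hT w] with x hv hw
  rw [hv, hw]

lemma integrable_quartic (hT : ∀ u, T u =ᵐ[volume.restrict Ω] fn u) (u : HSpace Ω m) :
    Integrable (fun x => ∑ i, ∑ j, g i j * fn (u i) x ^ 2 * fn (u j) x ^ 2)
      (volume.restrict Ω) := by
  simp only [mul_assoc]
  exact integrable_finsetSum _ fun i _ => integrable_finsetSum _ fun j _ =>
    (integrable_fn_sq_mul_fn_sq hT (u i) (u j)).const_mul (g i j)

lemma quarticPart_eq_sum (hT : ∀ u, T u =ᵐ[volume.restrict Ω] fn u) (u : HSpace Ω m) :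
    quarticPart Ω g u =
      ∑ i, ∑ j, g i j * ∫ x in Ω, T (u i) x ^ 2 * T (u j) x ^ 2 := by
  have hint (i j : Fin m) := (integrable_fn_sq_mul_fn_sq hT (u i) (u j)).const_mul (g i j)
  simp only [quarticPart, mul_assoc]
  rw [integral_finsetSum _ fun i _ => integrable_finsetSum _ fun j _ => hint i j]
  refine Finset.sum_congr rfl fun i _ => ?_
  rw [integral_finsetSum _ fun j _ => hint i j]
  refine Finset.sum_congr rfl fun j _ => ?_
  rw [integral_const_mul]
  congr 1
  refine integral_congr_ae ?_
  filter_upwards [hT (u i), hT (u j)] with x hi hj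
  rw [hi, hj]

lemma contDiff_quarticPart (hT : ∀ u, T u =ᵐ[volume.restrict Ω] fn u) :
    ContDiff ℝ n (quarticPart Ω g : HSpace Ω m → ℝ) := by
  rw [funext (quarticPart_eq_sum hT)]
  let P (i : Fin m) : HSpace Ω m →L[ℝ] Lp ℝ 4 (volume.restrict Ω) := T ∘L PiLp.proj 2 _ i
  exact ContDiff.sum fun i _ => ContDiff.sum fun j _ =>
    contDiff_const.mul (contDiff_integral_sq_mul_sq.comp ((P i).prod (P j)).contDiff)

theorem contDiff_energy (hT : ∀ u, T u =ᵐ[volume.restrict Ω] fn u)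
    (ha : ∀ i, MemLp (a i) ⊤ (volume.restrict Ω)) : ContDiff ℝ n (energy Ω ε a g) :=
  (contDiff_const.mul (contDiff_quadraticPart ha)).sub
    (contDiff_const.mul (contDiff_quarticPart hT))

lemma quarticPart_nonneg (hg : IsStrictlyCopositive g) (u : HSpace Ω m) :
    0 ≤ quarticPart Ω g u :=
  integral_nonneg fun _ => hg.nonneg fun _ => sq_nonneg _

lemma fn_eq_zero_of_quarticPart_eq_zero (hT : ∀ u, T u =ᵐ[volume.restrict Ω] fn u)
    (hg : IsStrictlyCopositive g) {u : HSpace Ω m} (hu : quarticPart Ω g u = 0) (i : Fin m) :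
    fn (u i) = 0 := by
  have hsum := (integral_eq_zero_iff_of_nonneg
    (fun _ => hg.nonneg fun _ => sq_nonneg _) (integrable_quartic hT u)).1 hu
  rw [Lp.eq_zero_iff_ae_eq_zero]
  filter_upwards [hsum] with x hx
  by_contra hi
  refine (hg (fun j => fn (u j) x ^ 2) (fun _ => sq_nonneg _) fun h0 => hi ?_).ne' hx
  simpa using congrFun h0 i

lemma grad_eq_zero_of_quadraticPart_eq_zero (hε : ∀ i, 0 < ε i)
    (ha : ∀ i, MemLp (a i) ⊤ (volume.restrict Ω)) {u : HSpace Ω m} (hfn : ∀ i, fn (u i) = 0)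
    (hu : quadraticPart Ω ε a u = 0) (i : Fin m) : grad (u i) = 0 := by
  have hzero (j : Fin m) : ∫ x in Ω, a j x * fn (u j) x ^ 2 = 0 := by
    refine integral_eq_zero_of_ae ?_
    filter_upwards [(Lp.eq_zero_iff_ae_eq_zero).1 (hfn j)] with x hx
    simp [hx]
  simp only [quadraticPart_eq_sum ha, hzero, add_zero] at hu
  have := (Finset.sum_eq_zero_iff_of_nonneg fun j _ => by have := hε j; positivity).1 hu i
    (Finset.mem_univ i)
  simpa [(hε i).ne'] using this

lemma quarticPart_pos (hT : ∀ u, T u =ᵐ[volume.restrict Ω] fn u) (hε : ∀ i, 0 < ε i)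
    (ha : ∀ i, MemLp (a i) ⊤ (volume.restrict Ω)) (hg : IsStrictlyCopositive g)
    {u : HSpace Ω m} (hu : u ≠ 0) (heq : quadraticPart Ω ε a u = quarticPart Ω g u) :
    0 < quarticPart Ω g u := by
  refine (quarticPart_nonneg hg u).lt_of_ne' fun h => hu ?_
  have hfn := fn_eq_zero_of_quarticPart_eq_zero hT hg h
  have hgrad := grad_eq_zero_of_quadraticPart_eq_zero hε ha hfn (heq.trans h)
  ext i : 1
  exact Subtype.ext (WithLp.ofLp_injective 2 (Prod.ext (hfn i) (hgrad i)))

theorem hessian_energy_self_neg (hT : ∀ u, T u =ᵐ[volume.restrict Ω] fn u)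
    (hε : ∀ i, 0 < ε i) (ha : ∀ i, MemLp (a i) ⊤ (volume.restrict Ω))
    (hg : IsStrictlyCopositive g) {u : HSpace Ω m} (hu : u ∈ nehari (energy Ω ε a g)) :
    hessian (energy Ω ε a g) u u u < 0 := by
  have hE : ContDiff ℝ 2 (energy Ω ε a g) := contDiff_energy hT ha
  have hray := fun t : ℝ => energy_smul (ε := ε) (a := a) (g := g) t u
  have heq : quadraticPart Ω ε a u = quarticPart Ω g u := by
    have h := fderiv_smul_apply_of_ray (hE.differentiable two_ne_zero) hray 1
    rw [one_smul, hu.2] at h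
    linarith
  rw [hessian_self_of_ray hE hray, heq]
  linarith [quarticPart_pos hT hε ha hg hu.1 heq]

end Energy

end Nehari

open Nehari in
theorem proposition2p3_general {N m : ℕ} (hN1 : 1 ≤ N) (hN4 : N ≤ 4)
    {Ω : Set (EuclideanSpace ℝ (Fin N))} (hΩ : Bornology.IsBounded Ω)
    {ε : Fin m → ℝ} (hε : ∀ i, 0 < ε i)
    {g : Matrix (Fin m) (Fin m) ℝ} (hg : IsStrictlyCopositive g)
    {a : Fin m → EuclideanSpace ℝ (Fin N) → ℝ} (ha : ∀ i, MemLp (a i) ⊤ (volume.restrict Ω)) :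
    ContDiff ℝ 2 (energy Ω ε a g) ∧
    (∀ u : HSpace Ω m, IsLocalMinimizerOn (energy Ω ε a g) (nehari (energy Ω ε a g)) u →
      IsOneSaddle (energy Ω ε a g) u) ∧
    (∀ u : HSpace Ω m, u ≠ 0 → IsOneSaddle (energy Ω ε a g) u →
      IsNondegenerate (energy Ω ε a g) u →
      IsStrictLocalMinimizerOn (energy Ω ε a g) (nehari (energy Ω ε a g)) u) := by
  obtain ⟨T, hT⟩ := exists_sobolevEmbedding hN1 hN4 hΩ
  have hE : ContDiff ℝ 2 (energy Ω ε a g) := contDiff_energy hT ha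
  refine ⟨hE, fun u hu => ?_, fun u hu0 hu hnd => ?_⟩
  · exact hu.isOneSaddle hE (hessian_energy_self_neg hT hε ha hg hu.1)
  · have hmem : u ∈ nehari (energy Ω ε a g) := ⟨hu0, by simp [hu.1.fderiv]⟩
    exact hu.isStrictLocalMinimizerOn hE (hessian_energy_self_neg hT hε ha hg hmem) hnd

theorem proposition2p3 {N m : ℕ} (hN1 : 1 ≤ N) (hN4 : N ≤ 4)
    (Ω : Set (EuclideanSpace ℝ (Fin N)))
    (hΩopen : IsOpen Ω) (hΩconn : IsConnected Ω) (hΩbdd : Bornology.IsBounded Ω)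
    (ε : Fin m → ℝ) (hε : ∀ i, 0 < ε i)
    (g : Matrix (Fin m) (Fin m) ℝ) (hgsymm : g.IsSymm)
    (hg : (∀ i j, 0 < g i j) ∨ g.PosDef)
    (a : Fin m → EuclideanSpace ℝ (Fin N) → ℝ)
    (ha : ∀ i, MemLp (a i) ⊤ (volume.restrict Ω))
    (ha1 : ∀ i, ∀ᵐ x ∂(volume.restrict Ω), -Nehari.firstDirichletEigenvalue Ω < a i x) :
    ContDiff ℝ 2 (Nehari.energy Ω ε a g) ∧
    (∀ u : Nehari.HSpace Ω m,
      Nehari.IsLocalMinimizerOn (Nehari.energy Ω ε a g)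
        (Nehari.nehari (Nehari.energy Ω ε a g)) u →
      Nehari.IsOneSaddle (Nehari.energy Ω ε a g) u) ∧
    (∀ u : Nehari.HSpace Ω m, u ≠ 0 →
      Nehari.IsOneSaddle (Nehari.energy Ω ε a g) u →
      Nehari.IsNondegenerate (Nehari.energy Ω ε a g) u →
      Nehari.IsStrictLocalMinimizerOn (Nehari.energy Ω ε a g)
        (Nehari.nehari (Nehari.energy Ω ε a g)) u) :=
  proposition2p3_general hN1 hN4 hΩbdd hε
    (hg.elim Nehari.isStrictlyCopositive_of_pos Nehari.isStrictlyCopositive_of_posDef) ha
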